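/- **Setting.** Let $d,n\ge 0$ be integers and let $O_1,\dots,O_n$ be Hermitian $2^d\times 2^d$ matrices (observables). Write $\langle O\rangle_\rho=\operatorname{Tr}(\rho O)$ and let $\mathcal S_0$ be the set of $d$-qubit density matrices $\rho$ with $\langle O_i\rangle_\rho\le 0$ for all $i$. *Measurement.* At each time $t\ge1$ a fresh system in state $\rho^t$ is measured: a unitary $U^t$ is drawn, independently of everything else, from one of the following ensembles: (a) local Clifford, $U^t=U_1\otimes\cdots\otimes U_d$ with the $U_k$ independent and uniform on the single-qubit Clifford group modulo phases; (a') the same with $U_k$ uniform on $\{I,H,HS^\dagger\}$, where $H$ is the Hadamard gate and $S=\mathrm{diag}(1,i)$; (b) joint Clifford, $U^t$ uniform on the $d$-qubit Clifford group modulo phases. Then $X^t\in\{0,1\}^d$ is observed with $\Pr[X^t=x\mid U^t]=\langle x|U^t\rho^t(U^t)^\dagger|x\rangle$. Put $\sigma^t=(U^t)^\dagger|X^t\rangle\langle X^t|U^t$, let $\mathcal R(A)=\mathbb E_U\big[\sum_x\langle x|UAU^\dagger|x\rangle\,U^\dagger|x\rangle\langle x|U\big]$ be the measurement channel, and let $\hat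 o_i^t=\operatorname{Tr}\big(O_i\,\mathcal R^{-1}(\sigma^t)\big)$. Let $l_i$ and $u_i$ be the smallest and largest values of $\hat o_i^t$ over all possible pairs $(U,x)$. *Detector.* Let $w_i>0$ with $\sum_iw_i=1$, let $\alpha\in(0,1)$, and let $\lambda_i^t$ be predictable bets, i.e. functions of $(U^1,X^1),\dots,(U^{t-1},X^{t-1})$, in the admissible range $\Lambda_i=\{\lambda: 1+\lambda l_i>0,\ 1+\lambda u_i>0\}$, which is $(-u_i^{-1},-l_i^{-1})$ if $l_i<0<u_i$. Put $L_i^t=1+\lambda_i^t\hat o_i^t$, $M^0_{\mathrm{SR},i}=M^0_{\mathrm{CU},i}=0$, $M^t_{\mathrm{SR},i}=L_i^t\,(M^{t-1}_{\mathrm{SR},i}+1)$, $M^t_{\mathrm{CU},i}=L_i^t\max\{M^{t-1}_{\mathrm{CU},i},1\}$, $M^t_{\bullet}=\sum_iw_iM^t_{\bullet,i}$, and $$T_{\mathrm{eSCD}}=\inf\{t\ge1:M^t_{\mathrm{SR}}\ge1/\alpha\},\qquad T_{\mathrm{eSCD\text{-}CU}}=\inf\{t\ge1:M^t_{\mathrm{CU}}\ge1/\alpha\}\qquad(\inf\emptyset=\infty).$$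 **Theorem (ARL control).** The channel $\mathcal R$ is invertible, so the protocol is well defined, and, for $T\in\{T_{\mathrm{eSCD}},T_{\mathrm{eSCD\text{-}CU}}\}$: 1. Suppose that for each $i$ either $O_i$ is positive semidefinite or $\lambda_i^t\ge0$ for all $t$. Then $\mathbb E_{\{\rho^t\}}[T]\ge 1/\alpha$ for every sequence $\{\rho^t\}_{t\ge1}$ of states in $\mathcal S_0$. In particular, if $\mathcal S_0\neq\emptyset$, then $\sup_{\rho_0\in\mathcal S_0}\mathbb E_{\rho_0}[T]\ge 1/\alpha$, where $\mathbb E_{\rho_0}$ refers to the constant sequence $\rho^t=\rho_0$. 2. For arbitrary admissible predictable bets of either sign, $\sup_{\rho_0\in\mathcal S_0}\mathbb E_{\rho_0}[T]\ge1/\alpha$ as soon as there is a state $\rho_0$ with $\langle O_i\rangle_{\rho_0}=0$ for all $i$ (for example, if all $O_i$ are traceless). -/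

import Mathlib

open MeasureTheory Matrix
open scoped ENNReal ComplexOrder

namespace ESCD

noncomputable section

/-! ### Quantum states and observables -/

/-- Density matrices on the Hilbert space with computational basis `m`. -/
structure DensityMatrix (m : Type) [Fintype m] where
  mat : Matrix m m ℂ
  posSemidef : mat.PosSemidef
  trace_eq_one : mat.trace = 1

/-- The expectation `⟨O⟩_ρ = Tr(ρ O)` (a real number whenever `O` is Hermitian). -/
def expectation {m : Type} [Fintype m] (O : Matrix m m ℂ) (ρ : DensityMatrix m) : ℝ :=
  (ρ.mat * O).trace.re

/-- The pre-change set `S₀`: the states with `⟨O i⟩_ρ ≤ 0` for every `i`. -/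
def preChange {m : Type} [Fintype m] {n : ℕ} (O : Fin n → Matrix m m ℂ) :
    Set (DensityMatrix m) :=
  {ρ | ∀ i, expectation (O i) ρ ≤ 0}

/-! ### Randomized measurements and classical shadows -/

/-- A finite ensemble of unitaries; a random unitary is obtained by drawing an index uniformly. -/
structure UnitaryEnsemble (m : Type) [Fintype m] [DecidableEq m] where
  Index : Type
  [fintypeIndex : Fintype Index]
  [nonemptyIndex : Nonempty Index]
  unitary : Index → Matrix.unitaryGroup m ℂ

attribute [instance] UnitaryEnsemble.fintypeIndex UnitaryEnsemble.nonemptyIndex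

namespace UnitaryEnsemble

variable {m : Type} [Fintype m] [DecidableEq m] (E : UnitaryEnsemble m)

/-- The record `(U, x)` of one measurement round: which unitary was drawn and which
computational-basis outcome was observed. -/
structure Record : Type where
  index : E.Index
  outcome : m

/-- Records are pairs. -/
def recordEquiv : E.Index × m ≃ E.Record where
  toFun p := ⟨p.1, p.2⟩
  invFun r := (r.index, r.outcome)
  left_inv _ := rfl
  right_inv _ := rfl

instance : Fintype E.Record := Fintype.ofEquiv _ E.recordEquiv
instance : MeasurableSpace E.Record := ⊤
instance : DiscreteMeasurableSpace E.Record := ⟨fun _ => trivial⟩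

/-- The snapshot `σ = U† |x⟩⟨x| U`, which is also the POVM element `Π_x` of the measurement
associated with `U`. -/
def snapshot (r : E.Record) : Matrix m m ℂ :=
  (E.unitary r.index : Matrix m m ℂ)ᴴ * Matrix.single r.outcome r.outcome 1 *
    (E.unitary r.index : Matrix m m ℂ)

/-- The measurement channel `R(A) = 𝔼_U [∑ x, ⟨x|U A U†|x⟩ U†|x⟩⟨x|U]`, with `U` uniform. -/
def channel : Module.End ℂ (Matrix m m ℂ) where
  toFun A := (Fintype.card E.Index : ℂ)⁻¹ •
    ∑ r : E.Record, (E.snapshot r * A).trace • E.snapshot r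
  map_add' A B := by
    simp only [Matrix.mul_add, Matrix.trace_add, add_smul, Finset.sum_add_distrib, smul_add]
  map_smul' c A := by
    simp only [Matrix.mul_smul, Matrix.trace_smul, smul_eq_mul, mul_smul, ← Finset.smul_sum,
      RingHom.id_apply]
    rw [smul_comm]

/-- The classical shadow `R⁻¹(σ)`. -/
def shadow (r : E.Record) : Matrix m m ℂ := (Ring.inverse E.channel) (E.snapshot r)

/-- The estimate `Tr(O R⁻¹(σ))` of the expectation of `O` (real when `O` is Hermitian). -/
def estimate (O : Matrix m m ℂ) (r : E.Record) : ℝ := (O * E.shadow r).trace.re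

/-- The smallest possible value of the estimate. -/
def estimateMin (O : Matrix m m ℂ) : ℝ := ⨅ r, E.estimate O r

/-- The largest possible value of the estimate. -/
def estimateMax (O : Matrix m m ℂ) : ℝ := ⨆ r, E.estimate O r

/-- The Born probability `Tr(Π_x ρ)`. -/
def born (ρ : DensityMatrix m) (r : E.Record) : ℝ := (E.snapshot r * ρ.mat).trace.re

theorem born_nonneg (ρ : DensityMatrix m) (r : E.Record) : 0 ≤ E.born ρ r := by
  have h : E.born ρ r = (((E.unitary r.index : Matrix m m ℂ) * ρ.mat *
      (E.unitary r.index : Matrix m m ℂ)ᴴ) r.outcome r.outcome).re := by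
    unfold born snapshot
    rw [Matrix.mul_assoc, Matrix.mul_assoc, Matrix.trace_mul_comm, Matrix.mul_assoc,
      Matrix.trace_single_mul]
    simp [Matrix.mul_assoc]
  rw [h]
  have h2 := (ρ.posSemidef.mul_mul_conjTranspose_same
    (E.unitary r.index : Matrix m m ℂ)).diag_nonneg (i := r.outcome)
  exact (Complex.le_def.1 h2).1

theorem sum_born (ρ : DensityMatrix m) (u : E.Index) : ∑ x : m, E.born ρ ⟨u, x⟩ = 1 := by
  simp only [born, snapshot]
  rw [← Complex.re_sum, ← Matrix.trace_sum, ← Finset.sum_mul, ← Finset.sum_mul, ← Finset.mul_sum]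
  have h1 : ∑ x : m, Matrix.single x x (1 : ℂ) = 1 := Matrix.sum_single_one
  have h2 : (E.unitary u : Matrix m m ℂ)ᴴ * (E.unitary u : Matrix m m ℂ) = 1 :=
    Matrix.mem_unitaryGroup_iff'.1 (E.unitary u).2
  rw [h1, Matrix.mul_one, h2, Matrix.one_mul, ρ.trace_eq_one, Complex.one_re]

/-- The law of one round on the state `ρ`: `U` is uniform, and given `U` the outcome `x` has
probability `Tr(Π_x ρ)`. -/
def roundLaw (ρ : DensityMatrix m) : PMF E.Record :=
  PMF.ofFintype (fun r => (Fintype.card E.Index : ℝ≥0∞)⁻¹ * ENNReal.ofReal (E.born ρ r)) <| by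
    rw [← Finset.mul_sum]
    have h : ∑ r : E.Record, ENNReal.ofReal (E.born ρ r) = Fintype.card E.Index := by
      calc ∑ r : E.Record, ENNReal.ofReal (E.born ρ r)
          = ∑ u : E.Index, ∑ x : m, ENNReal.ofReal (E.born ρ ⟨u, x⟩) := by
            rw [← E.recordEquiv.sum_comp, Fintype.sum_prod_type]
            rfl
        _ = ∑ _u : E.Index, 1 := by
            refine Finset.sum_congr rfl fun u _ => ?_
            rw [← ENNReal.ofReal_sum_of_nonneg fun x _ => E.born_nonneg ρ _, E.sum_born,
              ENNReal.ofReal_one]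
        _ = Fintype.card E.Index := by simp
    rw [h]
    exact ENNReal.inv_mul_cancel (by simp) (by simp)

/-- The law of the whole measurement record when the states `ρ 0, ρ 1, …` are measured one after
the other, each with its own independent random unitary. -/
def law (ρ : ℕ → DensityMatrix m) : Measure (ℕ → E.Record) :=
  Measure.infinitePi fun t => (E.roundLaw (ρ t)).toMeasure

/-- The admissible bets on the estimate of `O`: those whose capital multiplier `1 + b ô` is positive
at the extreme values `l` and `u` of the estimate, hence at all its values. This is the interval
`(-u⁻¹, -l⁻¹)` when `l < 0 < u` (see `admissibleBets_eq_Ioo`). -/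
def admissibleBets (O : Matrix m m ℂ) : Set ℝ :=
  {b | 0 < 1 + b * E.estimateMin O ∧ 0 < 1 + b * E.estimateMax O}

theorem admissibleBets_eq_Ioo (O : Matrix m m ℂ) (hl : E.estimateMin O < 0)
    (hu : 0 < E.estimateMax O) :
    E.admissibleBets O = Set.Ioo (-(E.estimateMax O)⁻¹) (-(E.estimateMin O)⁻¹) := by
  ext b
  have h1 : b < -(E.estimateMin O)⁻¹ ↔ 0 < 1 + b * E.estimateMin O := by
    rw [← inv_neg, ← one_div, lt_div_iff₀ (neg_pos.2 hl)]
    constructor <;> intro h <;> linarith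
  have h2 : -(E.estimateMax O)⁻¹ < b ↔ 0 < 1 + b * E.estimateMax O := by
    rw [neg_lt, ← one_div, lt_div_iff₀ hu]
    constructor <;> intro h <;> linarith
  simp only [admissibleBets, Set.mem_ofPred_eq, Set.mem_Ioo, h1, h2]
  exact and_comm

/-- A predictable betting strategy: the bet of round `t + 1` is a function of the records of the
`t` previous rounds. -/
abbrev Bets : Type := (t : ℕ) → (Fin t → E.Record) → ℝ

/-- The baseline increment `1 + b ô` of round `t + 1`, along the trajectory `ω` of records. -/
def increment (O : Matrix m m ℂ) (bet : E.Bets) (ω : ℕ → E.Record) (t : ℕ) : ℝ :=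
  1 + bet t (fun s => ω s) * E.estimate O (ω t)

/-- The Shiryaev–Roberts e-detector of a single observable after `t` rounds. -/
def srSingle (O : Matrix m m ℂ) (bet : E.Bets) (ω : ℕ → E.Record) : ℕ → ℝ
  | 0 => 0
  | t + 1 => E.increment O bet ω t * (srSingle O bet ω t + 1)

/-- The CUSUM e-detector of a single observable after `t` rounds. -/
def cusumSingle (O : Matrix m m ℂ) (bet : E.Bets) (ω : ℕ → E.Record) : ℕ → ℝ
  | 0 => 0
  | t + 1 => E.increment O bet ω t * max (cusumSingle O bet ω t) 1

variable {n : ℕ}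

/-- The aggregate Shiryaev–Roberts e-detector. -/
def srDetector (O : Fin n → Matrix m m ℂ) (w : Fin n → ℝ) (bet : Fin n → E.Bets)
    (ω : ℕ → E.Record) (t : ℕ) : ℝ :=
  ∑ i, w i * E.srSingle (O i) (bet i) ω t

/-- The aggregate CUSUM e-detector. -/
def cusumDetector (O : Fin n → Matrix m m ℂ) (w : Fin n → ℝ) (bet : Fin n → E.Bets)
    (ω : ℕ → E.Record) (t : ℕ) : ℝ :=
  ∑ i, w i * E.cusumSingle (O i) (bet i) ω t

end UnitaryEnsemble

/-- `inf {t ≥ 1 : M t ≥ c}`, equal to `∞` if there is no such `t`. -/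
def firstPassage (M : ℕ → ℝ) (c : ℝ) : ℕ∞ := ⨅ (t : ℕ) (_ : 1 ≤ t ∧ c ≤ M t), (t : ℕ∞)

namespace UnitaryEnsemble

variable {m : Type} [Fintype m] [DecidableEq m] (E : UnitaryEnsemble m) {n : ℕ}

/-- The stopping time of eSCD, with threshold `1 / α`. -/
def stopSR (O : Fin n → Matrix m m ℂ) (w : Fin n → ℝ) (bet : Fin n → E.Bets) (α : ℝ)
    (ω : ℕ → E.Record) : ℕ∞ :=
  firstPassage (E.srDetector O w bet ω) (1 / α)

/-- The stopping time of eSCD-CU, with threshold `1 / α`. -/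
def stopCU (O : Fin n → Matrix m m ℂ) (w : Fin n → ℝ) (bet : Fin n → E.Bets) (α : ℝ)
    (ω : ℕ → E.Record) : ℕ∞ :=
  firstPassage (E.cusumDetector O w bet ω) (1 / α)

/-- The expectation `𝔼_{ρ^1, ρ^2, …}[T] ∈ [0, ∞]` of a random time under a sequence of states. -/
def meanTime (ρ : ℕ → DensityMatrix m) (T : (ℕ → E.Record) → ℕ∞) : ℝ≥0∞ :=
  ∫⁻ ω, (T ω : ℝ≥0∞) ∂(E.law ρ)

/-- The average run length `sup_{ρ₀ ∈ S₀} 𝔼_{ρ₀}[T]`. -/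
def arl (O : Fin n → Matrix m m ℂ) (T : (ℕ → E.Record) → ℕ∞) : ℝ≥0∞ :=
  ⨆ ρ₀ ∈ preChange O, E.meanTime (fun _ => ρ₀) T

end UnitaryEnsemble

/-! ### Pauli strings and the Clifford group -/

/-- The matrices `I, X, Y, Z`. -/
def pauli : Fin 4 → Matrix (Fin 2) (Fin 2) ℂ :=
  ![1, !![0, 1; 1, 0], !![0, -Complex.I; Complex.I, 0], !![1, 0; 0, -1]]

/-- The tensor product `A₁ ⊗ ⋯ ⊗ A_d`, a matrix indexed by `d`-bit strings. -/
def tensor {d : ℕ} (A : Fin d → Matrix (Fin 2) (Fin 2) ℂ) :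
    Matrix (Fin d → Fin 2) (Fin d → Fin 2) ℂ :=
  Matrix.of fun x y => ∏ k, A k (x k) (y k)

theorem tensor_mul {d : ℕ} (A B : Fin d → Matrix (Fin 2) (Fin 2) ℂ) :
    tensor A * tensor B = tensor (fun k => A k * B k) := by
  ext x y
  simp only [tensor, Matrix.mul_apply, Matrix.of_apply, ← Finset.prod_mul_distrib]
  rw [Finset.prod_univ_sum, Fintype.piFinset_univ]

theorem tensor_conjTranspose {d : ℕ} (A : Fin d → Matrix (Fin 2) (Fin 2) ℂ) :
    (tensor A)ᴴ = tensor (fun k => (A k)ᴴ) := by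
  ext x y
  simp [tensor, Matrix.conjTranspose_apply]

theorem tensor_one {d : ℕ} : tensor (fun _ : Fin d => (1 : Matrix (Fin 2) (Fin 2) ℂ)) = 1 := by
  ext x y
  simp only [tensor, Matrix.of_apply, Matrix.one_apply, Finset.prod_ite_zero, Finset.mem_univ,
    true_imp_iff, Finset.prod_const_one, funext_iff]

theorem tensor_mem_unitaryGroup {d : ℕ} (A : Fin d → Matrix.unitaryGroup (Fin 2) ℂ) :
    tensor (fun k => (A k : Matrix (Fin 2) (Fin 2) ℂ)) ∈
      Matrix.unitaryGroup (Fin d → Fin 2) ℂ := by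
  rw [Matrix.mem_unitaryGroup_iff, Matrix.star_eq_conjTranspose, tensor_conjTranspose, tensor_mul,
    ← tensor_one]
  congr 1
  funext k
  exact Matrix.mem_unitaryGroup_iff.1 (A k).2

/-- The Pauli string `P₁ ⊗ ⋯ ⊗ P_d`. -/
def pauliString {d : ℕ} (p : Fin d → Fin 4) : Matrix (Fin d → Fin 2) (Fin d → Fin 2) ℂ :=
  tensor fun k => pauli (p k)

/-- The `d`-qubit Pauli group: Pauli strings times a phase in `{1, i, -1, -i}`. -/
def pauliGroup (d : ℕ) : Set (Matrix.unitaryGroup (Fin d → Fin 2) ℂ) :=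
  {P | ∃ c : ℂ, c ^ 4 = 1 ∧ ∃ p : Fin d → Fin 4,
    (P : Matrix (Fin d → Fin 2) (Fin d → Fin 2) ℂ) = c • pauliString p}

/-- The `d`-qubit Clifford group: the normalizer of the Pauli group in the unitary group. -/
def cliffordGroup (d : ℕ) : Subgroup (Matrix.unitaryGroup (Fin d → Fin 2) ℂ) :=
  Subgroup.normalizer (pauliGroup d)

/-- The global phases. -/
def phases (d : ℕ) : Subgroup (Matrix.unitaryGroup (Fin d → Fin 2) ℂ) where
  carrier := {V | ∃ c : ℂ, (V : Matrix (Fin d → Fin 2) (Fin d → Fin 2) ℂ) = c • 1}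
  mul_mem' := by
    rintro V W ⟨a, ha⟩ ⟨b, hb⟩
    exact ⟨a * b, by simp [ha, hb, mul_smul, smul_comm a b]⟩
  one_mem' := ⟨1, by simp⟩
  inv_mem' := by
    rintro V ⟨a, ha⟩
    exact ⟨star a, by
      rw [Matrix.UnitaryGroup.inv_val, ha, Matrix.star_eq_conjTranspose,
        Matrix.conjTranspose_smul, Matrix.conjTranspose_one]⟩

/-- The Clifford group modulo global phases. A phase affects neither the measurement nor the
snapshot, and the quotient is finite. -/
abbrev CliffordClass (d : ℕ) : Type := cliffordGroup d ⧸ (phases d).subgroupOf (cliffordGroup d)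

theorem pauli_mul_conjTranspose (a : Fin 4) : pauli a * (pauli a)ᴴ = 1 := by
  fin_cases a <;> ext i j <;> fin_cases i <;> fin_cases j <;>
    simp [pauli, Matrix.mul_apply, Fin.sum_univ_two]

theorem pauliString_mem_unitaryGroup {d : ℕ} (p : Fin d → Fin 4) :
    pauliString p ∈ Matrix.unitaryGroup (Fin d → Fin 2) ℂ :=
  tensor_mem_unitaryGroup
    (fun k => ⟨pauli (p k), Matrix.mem_unitaryGroup_iff.2 (pauli_mul_conjTranspose (p k))⟩)

theorem pauliGroup_finite (d : ℕ) : (pauliGroup d).Finite := by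
  have hc : {c : ℂ | c ^ 4 = 1}.Finite := by
    refine (Polynomial.nthRoots 4 (1 : ℂ)).toFinset.finite_toSet.subset fun c hc => ?_
    simpa [Polynomial.mem_nthRoots] using hc
  have hfin : (Set.image2 (fun (c : ℂ) (p : Fin d → Fin 4) => c • pauliString p)
      {c : ℂ | c ^ 4 = 1} Set.univ).Finite := hc.image2 _ Set.finite_univ
  refine Set.Finite.of_finite_image (f := Subtype.val) (hfin.subset ?_)
    Subtype.val_injective.injOn
  rintro _ ⟨P, ⟨c, hc4, p, hp⟩, rfl⟩
  exact ⟨c, hc4, p, trivial, hp.symm⟩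

/-- A matrix commuting with all Pauli strings is a scalar. -/
theorem eq_smul_one_of_commute_pauliString {d : ℕ}
    (V : Matrix (Fin d → Fin 2) (Fin d → Fin 2) ℂ)
    (hV : ∀ p : Fin d → Fin 4, V * pauliString p = pauliString p * V) :
    ∃ c : ℂ, V = c • 1 := by
  have hX : ∀ a x y : Fin d → Fin 2,
      pauliString (fun k => if a k = 0 then 0 else 1) x y = if y = x + a then (1 : ℂ) else 0 := by
    intro a x y
    have h : ∀ a x y : Fin 2,
        pauli (if a = 0 then 0 else 1) x y = if y = x + a then (1 : ℂ) else 0 := by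
      intro a x y
      fin_cases a <;> fin_cases x <;> fin_cases y <;> simp [pauli]
    simp only [pauliString, tensor, Matrix.of_apply, h, Finset.prod_ite_zero, Finset.mem_univ,
      true_imp_iff, Finset.prod_const_one, funext_iff, Pi.add_apply]
  have hZ : ∀ (k : Fin d), pauliString (Function.update (fun _ => 0) k 3) =
      Matrix.diagonal (fun x : Fin d → Fin 2 => if x k = 0 then (1 : ℂ) else -1) := by
    intro k
    ext x y
    rw [Matrix.diagonal_apply]
    simp only [pauliString, tensor, Matrix.of_apply]
    by_cases hxy : x = y
    · subst hxy
      rw [if_pos rfl, Finset.prod_eq_single k]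
      · have h : ∀ a : Fin 2, pauli 3 a a = if a = 0 then (1 : ℂ) else -1 := by
          intro a
          fin_cases a <;> simp [pauli]
        simp [h]
      · intro j _ hj
        simp [Function.update_of_ne hj, pauli]
      · simp
    · rw [if_neg hxy]
      obtain ⟨j, hj⟩ := Function.ne_iff.1 hxy
      refine Finset.prod_eq_zero (Finset.mem_univ j) ?_
      have h : ∀ a b : Fin 2, a ≠ b → pauli 3 a b = 0 ∧ pauli 0 a b = 0 := by
        intro a b hab
        fin_cases a <;> fin_cases b <;> simp_all [pauli]
      by_cases hjk : j = k
      · subst hjk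
        simpa using (h _ _ hj).1
      · rw [Function.update_of_ne hjk]
        exact (h _ _ hj).2
  have hoff : ∀ x y, x ≠ y → V x y = 0 := by
    intro x y hxy
    obtain ⟨k, hk⟩ := Function.ne_iff.1 hxy
    have h := congrFun (congrFun (hV (Function.update (fun _ => 0) k 3)) x) y
    rw [hZ, Matrix.mul_diagonal, Matrix.diagonal_mul] at h
    have h01 : ∀ a b : Fin 2, a ≠ b → (a = 0 ∧ b ≠ 0) ∨ (a ≠ 0 ∧ b = 0) := by decide
    rcases h01 _ _ hk with ⟨h0, h1⟩ | ⟨h0, h1⟩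
    · rw [if_pos h0, if_neg h1] at h
      linear_combination (-1 / 2 : ℂ) * h
    · rw [if_neg h0, if_pos h1] at h
      linear_combination (1 / 2 : ℂ) * h
  have hdiag : ∀ a : Fin d → Fin 2, V 0 0 = V a a := by
    intro a
    have h := congrFun (congrFun (hV (fun k => if a k = 0 then 0 else 1)) 0) a
    simp only [Matrix.mul_apply, hX, zero_add] at h
    simpa using h
  refine ⟨V 0 0, ?_⟩
  ext x y
  by_cases hxy : x = y
  · subst hxy
    simp [← hdiag x]
  · simp [hoff x y hxy, Matrix.one_apply_ne hxy]

instance (d : ℕ) : Finite (CliffordClass d) := by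
  have : Finite (pauliGroup d) := (pauliGroup_finite d).to_subtype
  let act (g : cliffordGroup d) (P : pauliGroup d) : pauliGroup d :=
    ⟨g.1 * P.1 * g.1⁻¹, (Subgroup.mem_set_normalizer_iff.1 g.2 P.1).1 P.2⟩
  refine Finite.of_injective (fun (q : CliffordClass d) => act q.out) ?_
  intro q q' hqq
  rw [← QuotientGroup.out_eq' q, ← QuotientGroup.out_eq' q', QuotientGroup.eq,
    Subgroup.mem_subgroupOf]
  set g := q.out
  set g' := q'.out
  refine eq_smul_one_of_commute_pauliString _ fun p => ?_
  let P : Matrix.unitaryGroup (Fin d → Fin 2) ℂ := ⟨pauliString p, pauliString_mem_unitaryGroup p⟩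
  have hP : P ∈ pauliGroup d := ⟨1, by simp, p, by simp [P]⟩
  have h : g.1 * P * g.1⁻¹ = g'.1 * P * g'.1⁻¹ := congrArg Subtype.val (congrFun hqq ⟨P, hP⟩)
  have h2 : (g.1⁻¹ * g'.1) * P = P * (g.1⁻¹ * g'.1) := by
    have h3 : g'.1 * P = g.1 * P * g.1⁻¹ * g'.1 := by rw [h]; group
    rw [mul_assoc, h3]; group
  exact congrArg Subtype.val h2

instance (d : ℕ) : Fintype (CliffordClass d) := Fintype.ofFinite _

/-! ### The measurement ensembles -/

/-- The joint Clifford ensemble: a uniformly random element of the `d`-qubit Clifford group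
(modulo global phases). -/
def jointClifford (d : ℕ) : UnitaryEnsemble (Fin d → Fin 2) where
  Index := CliffordClass d
  unitary q := (q.out : cliffordGroup d).1

/-- Renaming of the computational basis. -/
def UnitaryEnsemble.reindex {m k : Type} [Fintype m] [DecidableEq m] [Fintype k] [DecidableEq k]
    (E : UnitaryEnsemble m) (e : m ≃ k) : UnitaryEnsemble k where
  Index := E.Index
  unitary u := ⟨(E.unitary u : Matrix m m ℂ).submatrix e.symm e.symm, by
    rw [Matrix.mem_unitaryGroup_iff, Matrix.star_eq_conjTranspose, Matrix.conjTranspose_submatrix,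
      Matrix.submatrix_mul_equiv, ← Matrix.star_eq_conjTranspose,
      Matrix.mem_unitaryGroup_iff.1 (E.unitary u).2, Matrix.submatrix_one_equiv]⟩

/-- Independent draws `U₁ ⊗ ⋯ ⊗ U_d` from a single-qubit ensemble. -/
def localEnsemble (E : UnitaryEnsemble (Fin 2)) (d : ℕ) : UnitaryEnsemble (Fin d → Fin 2) where
  Index := Fin d → E.Index
  unitary u := ⟨tensor fun k => (E.unitary (u k) : Matrix (Fin 2) (Fin 2) ℂ),
    tensor_mem_unitaryGroup fun k => E.unitary (u k)⟩

/-- The local Clifford ensemble: `U₁ ⊗ ⋯ ⊗ U_d` with independent `U_k`, uniform in the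
single-qubit Clifford group (modulo global phases). -/
def localClifford (d : ℕ) : UnitaryEnsemble (Fin d → Fin 2) :=
  localEnsemble ((jointClifford 1).reindex (Equiv.funUnique (Fin 1) (Fin 2))) d

/-- The Hadamard gate `H`. -/
def hadamard : Matrix (Fin 2) (Fin 2) ℂ := ((√2 : ℝ) : ℂ)⁻¹ • !![1, 1; 1, -1]

/-- The phase gate `S`. -/
def phaseGate : Matrix (Fin 2) (Fin 2) ℂ := !![1, 0; 0, Complex.I]

theorem hadamard_mem : hadamard ∈ Matrix.unitaryGroup (Fin 2) ℂ := by
  have h : ((√2 : ℝ) : ℂ) * ((√2 : ℝ) : ℂ) = 2 := by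
    rw [← Complex.ofReal_mul, Real.mul_self_sqrt (by norm_num)]; norm_num
  have h2 : ((√2 : ℝ) : ℂ)⁻¹ * ((√2 : ℝ) : ℂ)⁻¹ = 1 / 2 := by
    rw [← mul_inv, h]; norm_num
  rw [Matrix.mem_unitaryGroup_iff, Matrix.star_eq_conjTranspose]
  ext i j
  fin_cases i <;> fin_cases j <;>
    simp [hadamard, Matrix.mul_apply, Fin.sum_univ_two, h2] <;> norm_num

theorem phaseGate_mem : phaseGate ∈ Matrix.unitaryGroup (Fin 2) ℂ := by
  rw [Matrix.mem_unitaryGroup_iff, Matrix.star_eq_conjTranspose]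
  ext i j
  fin_cases i <;> fin_cases j <;> simp [phaseGate, Matrix.mul_apply, Fin.sum_univ_two]

/-- The three single-qubit unitaries `I`, `H`, `H S†`, one of them drawn uniformly. -/
def pauliBasisEnsemble : UnitaryEnsemble (Fin 2) where
  Index := Fin 3
  unitary := ![1, ⟨hadamard, hadamard_mem⟩,
    ⟨hadamard, hadamard_mem⟩ * (⟨phaseGate, phaseGate_mem⟩ : Matrix.unitaryGroup (Fin 2) ℂ)⁻¹]

/-- The equivalent implementation of local Clifford measurements: each `U_k` is independent and
uniform in `{I, H, H S†}`. -/
def localPauliBasis (d : ℕ) : UnitaryEnsemble (Fin d → Fin 2) := localEnsemble pauliBasisEnsemble d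

end

end ESCD

/-! The threshold is `1 / α` because the Shiryaev–Roberts detector grows by at most one per round on
average. Its increment `1 + λ ô` is positive for admissible `λ`. Since the classical shadow is
unbiased, the increment has conditional mean `1 + λ ⟨O⟩`, which is at most 1 as soon as `λ ⟨O⟩ ≤ 0`
(`sum_roundLaw_mul_le_one`). With weights summing to one, the conditional mean of `M (t + 1)` is
then at most `M t + 1`, so `M t - t` is a supermartingale, and optional stopping gives `1 / α ≤
𝔼[M_T] ≤ 𝔼[T]` (`ofReal_le_lintegral_firstPassage`, `le_meanTime_stopSR`). The CUSUM detector is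
pathwise below the Shiryaev–Roberts one, hence stops no earlier. Both parts of the theorem are
instances of `λ ⟨O⟩ ≤ 0`: the states lie in `S₀` and the bets are nonnegative, or the expectations
vanish. A positive semidefinite observable falls under the second alternative.

Unbiasedness needs the channel `R` to be invertible. No explicit formula for `R` is used: `Tr(A†
R(A))` is the average over `U` of `∑ x, |Tr(σ A)|²`, so `R` is injective once the outcome statistics
determine `A`. This is checked by hand for `{I, H, H S†}` on one qubit, passes to tensor products
because snapshots span, and passes to the Clifford ensembles because they contain these unitaries.
-/

namespace ESCD

/-! ### Optional stopping for first-passage times -/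

/-- A nonnegative process which, as long as it has not reached the level `c`, grows on average by at
most one per step, needs an average time of at least `c` to reach `c`. -/
theorem ofReal_le_lintegral_firstPassage {Ω : Type*} [MeasurableSpace Ω] (μ : Measure Ω)
    [IsProbabilityMeasure μ] (M : Ω → ℕ → ℝ) (c : ℝ) (hM : ∀ t, Measurable fun ω => M ω t)
    (hM0 : ∀ ω, M ω 0 = 0)
    (hstep : ∀ t, ∫⁻ ω in {ω | ∀ s ∈ Finset.Icc 1 t, M ω s < c}, ENNReal.ofReal (M ω (t + 1)) ∂μ ≤
      ∫⁻ ω in {ω | ∀ s ∈ Finset.Icc 1 t, M ω s < c}, (ENNReal.ofReal (M ω t) + 1) ∂μ) :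
    ENNReal.ofReal c ≤ ∫⁻ ω, (firstPassage (M ω) c : ℝ≥0∞) ∂μ := by
  set A : ℕ → Set Ω := fun t => {ω | ∀ s ∈ Finset.Icc 1 t, M ω s < c} with hA
  have hAm : ∀ t, MeasurableSet (A t) := by
    intro t
    have : A t = ⋂ s ∈ Finset.Icc 1 t, {ω | M ω s < c} := by ext; simp [hA]
    rw [this]
    exact Finset.measurableSet_biInter _ fun s _ => measurableSet_lt (hM s) measurable_const
  have hmono : ∀ t, A (t + 1) ⊆ A t := fun t ω h s hs => h s (by
    simp only [Finset.mem_Icc] at hs ⊢; omega)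
  -- Here `A t` is the event `T > t`. This is optional stopping at `min T N`, by induction on `N`:
  -- paths that have crossed are credited only `c`, and each surviving path pays one unit per round.
  have key : ∀ N, ENNReal.ofReal c * μ (A N)ᶜ + ∫⁻ ω in A N, ENNReal.ofReal (M ω N) ∂μ ≤
      ∑ t ∈ Finset.range N, μ (A t) := by
    intro N
    induction N with
    | zero =>
      have : A 0 = Set.univ := by
        refine Set.eq_univ_of_forall fun ω s hs => ?_
        simp only [Finset.mem_Icc] at hs; omega
      simp [this, hM0]
    | succ N ih =>
      rw [Finset.sum_range_succ]
      have hsplit : (A (N + 1))ᶜ = (A N)ᶜ ∪ (A N \ A (N + 1)) := by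
        ext ω
        have := @hmono N ω
        simp only [Set.mem_compl_iff, Set.mem_union, Set.mem_sdiff]
        tauto
      -- On `A N \ A (N + 1)` the level is crossed exactly at time `N + 1`.
      have h1 : ENNReal.ofReal c * μ (A N \ A (N + 1)) ≤
          ∫⁻ ω in A N \ A (N + 1), ENNReal.ofReal (M ω (N + 1)) ∂μ := by
        rw [← setLIntegral_const]
        refine setLIntegral_mono' ((hAm N).diff (hAm _)) fun ω hω => ENNReal.ofReal_le_ofReal ?_
        by_contra! hlt
        refine hω.2 fun s hs => ?_
        rcases Nat.lt_or_ge N s with h | h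
        · have : s = N + 1 := by simp only [Finset.mem_Icc] at hs; omega
          rwa [this]
        · exact hω.1 s (by simp only [Finset.mem_Icc] at hs ⊢; omega)
      have h2 : ∫⁻ ω in A N \ A (N + 1), ENNReal.ofReal (M ω (N + 1)) ∂μ +
          ∫⁻ ω in A (N + 1), ENNReal.ofReal (M ω (N + 1)) ∂μ =
          ∫⁻ ω in A N, ENNReal.ofReal (M ω (N + 1)) ∂μ := by
        rw [← lintegral_union (hAm _) Set.disjoint_sdiff_left,
          Set.sdiff_union_of_subset (hmono N)]
      calc ENNReal.ofReal c * μ (A (N + 1))ᶜ + ∫⁻ ω in A (N + 1), ENNReal.ofReal (M ω (N + 1)) ∂μ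
          ≤ ENNReal.ofReal c * (μ (A N)ᶜ + μ (A N \ A (N + 1))) +
              ∫⁻ ω in A (N + 1), ENNReal.ofReal (M ω (N + 1)) ∂μ := by
            rw [hsplit]; gcongr; exact measure_union_le _ _
        _ ≤ ENNReal.ofReal c * μ (A N)ᶜ + ∫⁻ ω in A N, ENNReal.ofReal (M ω (N + 1)) ∂μ := by
            rw [mul_add, add_assoc, ← h2]; gcongr
        _ ≤ ENNReal.ofReal c * μ (A N)ᶜ + ∫⁻ ω in A N, (ENNReal.ofReal (M ω N) + 1) ∂μ := by
            exact add_le_add_right (hstep N) _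
        _ = (ENNReal.ofReal c * μ (A N)ᶜ + ∫⁻ ω in A N, ENNReal.ofReal (M ω N) ∂μ) + μ (A N) := by
            rw [lintegral_add_right _ measurable_const, setLIntegral_one, add_assoc]
        _ ≤ _ := by gcongr
  -- Tail-sum formula: the number of `t` with `t < T` is at most `T`.
  have hsum : ∀ N, ∑ t ∈ Finset.range N, μ (A t) ≤
      ∫⁻ ω, (firstPassage (M ω) c : ℝ≥0∞) ∂μ := by
    intro N
    calc ∑ t ∈ Finset.range N, μ (A t)
        = ∫⁻ ω, ∑ t ∈ Finset.range N, (A t).indicator 1 ω ∂μ := by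
          rw [lintegral_finsetSum _ fun t _ => measurable_one.indicator (hAm t)]
          exact Finset.sum_congr rfl fun t _ => (lintegral_indicator_one (hAm t)).symm
      _ ≤ _ := by
          refine lintegral_mono fun ω => ?_
          have hlt : ∀ t, ω ∈ A t → (t : ℕ∞) < firstPassage (M ω) c := by
            intro t ht
            refine (ENat.natCast_lt_natCast.2 (Nat.lt_succ_self t)).trans_le (le_iInf₂ fun s hs => ?_)
            by_contra! hst
            have : s ≤ t := Nat.lt_succ_iff.1 (ENat.natCast_lt_natCast.1 hst)
            exact absurd (ht s (Finset.mem_Icc.2 ⟨hs.1, this⟩)) (not_lt.2 hs.2)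
          generalize firstPassage (M ω) c = T at hlt
          induction T using ENat.recTopCoe with
          | top => simp
          | coe k =>
            calc ∑ t ∈ Finset.range N, (A t).indicator (1 : Ω → ℝ≥0∞) ω
                ≤ ∑ t ∈ Finset.range N, if t < k then (1 : ℝ≥0∞) else 0 := by
                  refine Finset.sum_le_sum fun t _ => ?_
                  by_cases h : ω ∈ A t
                  · rw [if_pos (ENat.natCast_lt_natCast.1 (hlt t h)), Set.indicator_of_mem h]; rfl
                  · rw [Set.indicator_of_notMem h]; exact bot_le
              _ ≤ k := by
                  rw [← Finset.sum_filter, Finset.sum_const, nsmul_one]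
                  refine Nat.cast_le.2 ?_
                  calc _ ≤ (Finset.range k).card := Finset.card_le_card fun t ht => by
                        simp only [Finset.mem_filter, Finset.mem_range] at ht ⊢; exact ht.2
                    _ = k := Finset.card_range k
              _ = _ := by simp
  set S := ∫⁻ ω, (firstPassage (M ω) c : ℝ≥0∞) ∂μ
  rcases eq_or_ne S ⊤ with hS | hS
  · rw [hS]; exact le_top
  have htsum : ∑' t, μ (A t) ≠ ⊤ :=
    ne_top_of_le_ne_top hS (ENNReal.tsum_le_of_sum_range_le hsum)
  have hlim := ENNReal.tendsto_atTop_zero_of_tsum_ne_top htsum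
  -- If `𝔼[T]` is finite, the tails `μ (T > N)` are summable and vanish, so the mass `c * μ (A N)`
  -- that has not crossed by time `N` is negligible.
  have hlim2 : Filter.Tendsto (fun N => S + ENNReal.ofReal c * μ (A N)) Filter.atTop (nhds S) := by
    simpa using (ENNReal.Tendsto.const_mul hlim (Or.inr ENNReal.ofReal_ne_top)).const_add S
  refine ge_of_tendsto' hlim2 fun N => ?_
  calc ENNReal.ofReal c = ENNReal.ofReal c * (μ (A N)ᶜ + μ (A N)) := by
        rw [add_comm, measure_add_measure_compl (hAm N), measure_univ, mul_one]
    _ ≤ _ := by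
        rw [mul_add]
        gcongr
        exact (le_self_add.trans (key N)).trans (hsum N)


/-! ### Tomographic completeness and invertibility of the channel -/

namespace UnitaryEnsemble

variable {m : Type} [Fintype m] [DecidableEq m] (E : UnitaryEnsemble m)

theorem snapshot_conjTranspose (r : E.Record) : (E.snapshot r)ᴴ = E.snapshot r := by
  simp [snapshot, Matrix.conjTranspose_mul, Matrix.mul_assoc]

/-- The measurement outcomes determine the matrix. -/
def TomographicallyComplete : Prop :=
  ∀ A : Matrix m m ℂ, (∀ r, (E.snapshot r * A).trace = 0) → A = 0

/-- Pairing `R(A) = 0` with `A†` gives a vanishing sum of the squares `|Tr(σ A)|²`, so every outcome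
statistic of `A` vanishes. Injectivity suffices in finite dimension. -/
theorem TomographicallyComplete.isUnit_channel {E : UnitaryEnsemble m}
    (hE : E.TomographicallyComplete) : IsUnit E.channel := by
  rw [Module.End.isUnit_iff]
  have hinj : Function.Injective E.channel := by
    rw [injective_iff_map_eq_zero]
    intro A hA
    refine hE A ?_
    have hs : ∑ r : E.Record, (E.snapshot r * A).trace • E.snapshot r = 0 := by
      have h : (Fintype.card E.Index : ℂ)⁻¹ •
        ∑ r : E.Record, (E.snapshot r * A).trace • E.snapshot r = 0 := hA
      exact (smul_eq_zero.1 h).resolve_left (by simp)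
    have h2 : ∑ r : E.Record, (E.snapshot r * A).trace * star (E.snapshot r * A).trace = 0 := by
      have h3 := congrArg (fun B => (Aᴴ * B).trace) hs
      simp only [Finset.mul_sum, Matrix.trace_sum, Matrix.mul_smul, Matrix.trace_smul, smul_eq_mul,
        Matrix.mul_zero, Matrix.trace_zero] at h3
      rw [← h3]
      refine Finset.sum_congr rfl fun r _ => ?_
      rw [← Matrix.trace_conjTranspose, Matrix.conjTranspose_mul, E.snapshot_conjTranspose]
    rw [Finset.sum_eq_zero_iff_of_nonneg fun r _ => mul_star_self_nonneg _] at h2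
    intro r
    simpa using h2 r (Finset.mem_univ r)
  exact ⟨hinj, LinearMap.injective_iff_surjective.1 hinj⟩

theorem TomographicallyComplete.of_snapshot {E F : UnitaryEnsemble m}
    (hF : F.TomographicallyComplete) (h : ∀ r : F.Record, ∃ r', E.snapshot r' = F.snapshot r) :
    E.TomographicallyComplete := by
  refine fun A hA => hF A fun r => ?_
  obtain ⟨r', hr'⟩ := h r
  rw [← hr']
  exact hA r'

theorem TomographicallyComplete.reindex {k : Type} [Fintype k] [DecidableEq k]
    {E : UnitaryEnsemble m} (hE : E.TomographicallyComplete) (e : m ≃ k) :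
    (E.reindex e).TomographicallyComplete := by
  intro A hA
  have hA' : A.submatrix e e = 0 := by
    refine hE _ fun r => ?_
    have h : (E.reindex e).snapshot ⟨r.index, e r.outcome⟩ =
        (E.snapshot r).submatrix e.symm e.symm := by
      have h1 : Matrix.single (e r.outcome) (e r.outcome) (1 : ℂ) =
          (Matrix.single r.outcome r.outcome (1 : ℂ)).submatrix e.symm e.symm := by
        ext i j
        simp [Matrix.single_apply, Equiv.eq_symm_apply]
      simp only [snapshot, UnitaryEnsemble.reindex, h1, Matrix.conjTranspose_submatrix,
        Matrix.submatrix_mul_equiv]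
    rw [← hA ⟨r.index, e r.outcome⟩, h]
    have h3 : (E.snapshot r).submatrix e.symm e.symm * A =
        (E.snapshot r * A.submatrix e e).submatrix e.symm e.symm := by
      rw [← Matrix.submatrix_mul_equiv _ _ _ e.symm]
      simp
    rw [h3]
    simp only [Matrix.trace, Matrix.diag, Matrix.submatrix_apply]
    exact (e.symm.sum_comp fun i => (E.snapshot r * A.submatrix e e) i i).symm
  have h4 : A = (A.submatrix e e).submatrix e.symm e.symm := by simp
  rw [h4, hA']
  rfl

/-- The representative picked by `out` differs from `g` by a phase of modulus one, which cancels in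
`U† |x⟩⟨x| U`. Thus the snapshots of every Clifford unitary occur in the ensemble. -/
theorem snapshot_mk_out {d : ℕ} (g : cliffordGroup d) (x : Fin d → Fin 2) :
    (jointClifford d).snapshot ⟨QuotientGroup.mk g, x⟩ =
      (g.1 : Matrix (Fin d → Fin 2) (Fin d → Fin 2) ℂ)ᴴ * Matrix.single x x 1 * g.1.1 := by
  set q : CliffordClass d := QuotientGroup.mk g with hq
  obtain ⟨c, hc⟩ : g.1⁻¹ * q.out.1 ∈ phases d := by
    have h : (QuotientGroup.mk g : CliffordClass d) = QuotientGroup.mk q.out := by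
      rw [QuotientGroup.out_eq', hq]
    rw [QuotientGroup.eq, Subgroup.mem_subgroupOf] at h
    exact h
  have hout : (q.out.1 : Matrix (Fin d → Fin 2) (Fin d → Fin 2) ℂ) = c • g.1.1 := by
    have h : q.out.1 = g.1 * (g.1⁻¹ * q.out.1) := by group
    rw [h, Matrix.UnitaryGroup.mul_val, hc, Matrix.mul_smul, Matrix.mul_one]
  have hcc : star c * c = 1 := by
    have h := Matrix.mem_unitaryGroup_iff'.1 (g.1⁻¹ * q.out.1).2
    rw [hc, Matrix.star_eq_conjTranspose, Matrix.conjTranspose_smul, Matrix.conjTranspose_one,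
      Matrix.smul_mul, Matrix.mul_smul, Matrix.one_mul, smul_smul] at h
    simpa using congrFun (congrFun h 0) 0
  have h : (jointClifford d).unitary q = q.out.1 := rfl
  simp only [snapshot, h, hout, Matrix.conjTranspose_smul, Matrix.smul_mul, Matrix.mul_smul,
    smul_smul]
  rw [mul_comm, hcc, one_smul]

theorem snapshot_localEnsemble (E : UnitaryEnsemble (Fin 2)) {d : ℕ} (u : Fin d → E.Index)
    (x : Fin d → Fin 2) :
    (localEnsemble E d).snapshot ⟨u, x⟩ = tensor fun k => E.snapshot ⟨u k, x k⟩ := by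
  have h : Matrix.single x x (1 : ℂ) = tensor fun k => Matrix.single (x k) (x k) 1 := by
    ext i j
    simp only [tensor, Matrix.of_apply, Matrix.single_apply, Finset.prod_ite_zero, Finset.mem_univ,
      true_imp_iff, Finset.prod_const_one, funext_iff, forall_and]
  simp only [snapshot, localEnsemble, h, tensor_conjTranspose, tensor_mul]

/-- The snapshots of a tomographically complete ensemble span the space of matrices. -/
theorem TomographicallyComplete.mem_span_snapshot {E : UnitaryEnsemble m}
    (hE : E.TomographicallyComplete) (B : Matrix m m ℂ) :
    B ∈ Submodule.span ℂ (Set.range E.snapshot) := by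
  obtain ⟨A, rfl⟩ := (Module.End.isUnit_iff _).1 hE.isUnit_channel |>.2 B
  exact Submodule.smul_mem _ _ (Submodule.sum_mem _ fun r _ =>
    Submodule.smul_mem _ _ (Submodule.subset_span ⟨r, rfl⟩))

/-- Single-qubit snapshots span, so by multilinearity their tensor products span all product
matrices, among them the matrix units, which read off the entries of `A`. -/
theorem TomographicallyComplete.localEnsemble {E : UnitaryEnsemble (Fin 2)}
    (hE : E.TomographicallyComplete) (d : ℕ) :
    (localEnsemble E d).TomographicallyComplete := by
  intro A hA
  have hcoef : ∀ B : Matrix (Fin 2) (Fin 2) ℂ, ∃ c : E.Record → ℂ, ∑ r, c r • E.snapshot r = B :=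
    fun B => (Submodule.mem_span_range_iff_exists_fun ℂ).1 (hE.mem_span_snapshot B)
  choose c hc using hcoef
  have hzero : ∀ B : Fin d → Matrix (Fin 2) (Fin 2) ℂ, (tensor B * A).trace = 0 := by
    intro B
    have h1 : tensor B = ∑ r : Fin d → E.Record, (∏ k, c (B k) (r k)) •
        tensor fun k => E.snapshot (r k) := by
      ext x y
      simp only [Matrix.sum_apply, Matrix.smul_apply, tensor, Matrix.of_apply, smul_eq_mul,
        ← Finset.prod_mul_distrib]
      rw [← Fintype.piFinset_univ,
        ← Finset.prod_univ_sum (fun _ => Finset.univ)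
          (fun k r => c (B k) r * E.snapshot r (x k) (y k))]
      refine Finset.prod_congr rfl fun k _ => ?_
      conv_lhs => rw [← hc (B k)]
      simp [Matrix.sum_apply]
    rw [h1, Finset.sum_mul, Matrix.trace_sum]
    refine Finset.sum_eq_zero fun r _ => ?_
    rw [Matrix.smul_mul, Matrix.trace_smul, ← snapshot_localEnsemble E (fun k => (r k).index), hA,
      smul_zero]
  ext x y
  have h := hzero fun k => Matrix.single (y k) (x k) 1
  have h2 : (tensor fun k => Matrix.single (y k) (x k) (1 : ℂ)) = Matrix.single y x 1 := by
    ext i j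
    simp only [tensor, Matrix.of_apply, Matrix.single_apply, Finset.prod_ite_zero, Finset.mem_univ,
      true_imp_iff, Finset.prod_const_one, funext_iff, forall_and]
  rw [h2, Matrix.trace_single_mul] at h
  simpa using h

theorem tomographicallyComplete_pauliBasisEnsemble :
    pauliBasisEnsemble.TomographicallyComplete := by
  intro A hA
  have h2 : ((√2 : ℝ) : ℂ)⁻¹ * ((√2 : ℝ) : ℂ)⁻¹ = 1 / 2 := by
    rw [← mul_inv, ← Complex.ofReal_mul, Real.mul_self_sqrt (by norm_num)]; norm_num
  -- Four outcomes suffice: the two of `I` give the diagonal of `A`, and one each of `H` and `H S†`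
  -- gives the sum and the difference of the off-diagonal entries.
  have e0 := hA ⟨(0 : Fin 3), 0⟩
  have e1 := hA ⟨(0 : Fin 3), 1⟩
  have e2 := hA ⟨(1 : Fin 3), 0⟩
  have e3 := hA ⟨(2 : Fin 3), 0⟩
  simp [snapshot, pauliBasisEnsemble, hadamard, phaseGate, Matrix.trace, Matrix.mul_apply,
    Fin.sum_univ_two, Matrix.single_apply, Matrix.star_eq_conjTranspose, Matrix.vecMul,
    dotProduct] at e0 e1 e2 e3
  rw [e0, e1] at e2 e3
  have e4 : A 1 0 + A 0 1 = 0 := by linear_combination 2 * e2 - 2 * (A 1 0 + A 0 1) * h2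
  have e5 : A 1 0 - A 0 1 = 0 := by
    refine (mul_eq_zero.1 (?_ : Complex.I * (A 1 0 - A 0 1) = 0)).resolve_left Complex.I_ne_zero
    linear_combination -2 * e3 - 2 * Complex.I * (A 1 0 - A 0 1) * h2
  ext i j
  fin_cases i <;> fin_cases j
  · exact e0
  · change A 0 1 = 0
    linear_combination (1 / 2) * e4 - (1 / 2) * e5
  · change A 1 0 = 0
    linear_combination (1 / 2) * e4 + (1 / 2) * e5
  · exact e1

end UnitaryEnsemble

/-! ### Pauli-basis rotations are Clifford -/

/-- Conjugation by `u` permutes the single-qubit Pauli matrices up to phases. -/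
def PermutesPauli (u : Matrix (Fin 2) (Fin 2) ℂ) : Prop :=
  ∀ a, ∃ c : ℂ, c ^ 4 = 1 ∧ ∃ b, u * pauli a = c • (pauli b * u)

theorem PermutesPauli.mul {u v : Matrix (Fin 2) (Fin 2) ℂ} (hu : PermutesPauli u)
    (hv : PermutesPauli v) : PermutesPauli (u * v) := by
  intro a
  obtain ⟨c, hc, b, hb⟩ := hv a
  obtain ⟨c', hc', b', hb'⟩ := hu b
  refine ⟨c * c', by rw [mul_pow, hc, hc', one_mul], b', ?_⟩
  rw [Matrix.mul_assoc, hb, Matrix.mul_smul, ← Matrix.mul_assoc, hb', Matrix.smul_mul, smul_smul,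
    Matrix.mul_assoc]

theorem permutesPauli_one : PermutesPauli 1 := fun a => ⟨1, by simp, a, by simp⟩

theorem permutesPauli_hadamard : PermutesPauli hadamard := by
  -- The factor `1 / √2` cancels, leaving an identity between matrices without roots.
  have h (a b : Fin 4) (c : ℂ) (h : !![1, 1; 1, -1] * pauli a = c • (pauli b * !![1, 1; 1, -1])) :
      hadamard * pauli a = c • (pauli b * hadamard) := by
    rw [hadamard, Matrix.smul_mul, h, Matrix.mul_smul, smul_comm]
  intro a
  fin_cases a
  · exact ⟨1, by norm_num, 0, h _ _ _ (by simp [pauli])⟩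
  · exact ⟨1, by norm_num, 3, h _ _ _ (by simp [pauli])⟩
  · exact ⟨-1, by norm_num, 2, h _ _ _ (by simp [pauli])⟩
  · exact ⟨1, by norm_num, 1, h _ _ _ (by simp [pauli])⟩

theorem permutesPauli_phaseGate : PermutesPauli phaseGate := by
  intro a
  fin_cases a
  · exact ⟨1, by norm_num, 0, by simp [pauli]⟩
  · exact ⟨1, by norm_num, 2, by simp [pauli, phaseGate]⟩
  · exact ⟨-1, by norm_num, 1, by simp [pauli, phaseGate]⟩
  · exact ⟨1, by norm_num, 3, by simp [pauli, phaseGate]⟩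

theorem permutesPauli_phaseGate_conjTranspose : PermutesPauli phaseGateᴴ := by
  have h : phaseGateᴴ = !![1, 0; 0, -Complex.I] := by
    ext i j
    fin_cases i <;> fin_cases j <;> simp [phaseGate]
  rw [h]
  intro a
  fin_cases a
  · exact ⟨1, by norm_num, 0, by simp [pauli]⟩
  · exact ⟨-1, by norm_num, 2, by simp [pauli]⟩
  · exact ⟨1, by norm_num, 1, by simp [pauli]⟩
  · exact ⟨1, by norm_num, 3, by simp [pauli]⟩

theorem hadamard_conjTranspose : hadamardᴴ = hadamard := by
  ext i j
  fin_cases i <;> fin_cases j <;> simp [hadamard]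

theorem conj_mem_pauliGroup {d : ℕ} (u : Fin d → Matrix (Fin 2) (Fin 2) ℂ)
    (hu : ∀ k, PermutesPauli (u k)) (g P : Matrix.unitaryGroup (Fin d → Fin 2) ℂ)
    (hg : (g : Matrix (Fin d → Fin 2) (Fin d → Fin 2) ℂ) = tensor u) (hP : P ∈ pauliGroup d) :
    g * P * g⁻¹ ∈ pauliGroup d := by
  obtain ⟨c, hc, p, hp⟩ := hP
  choose a ha q hq using fun k => hu k (p k)
  refine ⟨c * ∏ k, a k, ?_, q, ?_⟩
  · rw [mul_pow, hc, ← Finset.prod_pow, Finset.prod_congr rfl fun k _ => ha k]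
    simp
  · have h : (g * P).1 = ((c * ∏ k, a k) • pauliString q) * g.1 := by
      have h1 : (tensor fun k => a k • (pauli (q k) * u k)) =
          (∏ k, a k) • tensor fun k => pauli (q k) * u k := by
        ext x y
        simp [tensor, Finset.prod_mul_distrib]
      rw [Matrix.UnitaryGroup.mul_val, hp, hg, Matrix.mul_smul, pauliString, tensor_mul]
      simp only [hq]
      rw [h1, smul_smul, pauliString, Matrix.smul_mul, tensor_mul]
    rw [Matrix.UnitaryGroup.mul_val, h, Matrix.mul_assoc, ← Matrix.UnitaryGroup.mul_val,
      mul_inv_cancel, Matrix.UnitaryGroup.one_val, Matrix.mul_one]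

/-- Normalizing is an equivalence, so conjugation by `g⁻¹` must preserve the Pauli group as well;
hence the condition on the adjoints. -/
theorem mem_cliffordGroup_of_permutesPauli {d : ℕ} (u : Fin d → Matrix (Fin 2) (Fin 2) ℂ)
    (hu : ∀ k, PermutesPauli (u k)) (hu' : ∀ k, PermutesPauli (u k)ᴴ)
    (g : Matrix.unitaryGroup (Fin d → Fin 2) ℂ)
    (hg : (g : Matrix (Fin d → Fin 2) (Fin d → Fin 2) ℂ) = tensor u) : g ∈ cliffordGroup d := by
  refine Subgroup.mem_set_normalizer_iff.2 fun P =>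
    ⟨conj_mem_pauliGroup u hu g P hg, fun hP => ?_⟩
  have h := conj_mem_pauliGroup (fun k => (u k)ᴴ) hu' g⁻¹ _ (by
    rw [Matrix.UnitaryGroup.inv_val, Matrix.star_eq_conjTranspose, hg, tensor_conjTranspose]) hP
  have h2 : g⁻¹ * (g * P * g⁻¹) * g⁻¹⁻¹ = P := by group
  rwa [h2] at h

theorem pauliBasisEnsemble_permutesPauli (k : pauliBasisEnsemble.Index) :
    PermutesPauli (pauliBasisEnsemble.unitary k).1 ∧
      PermutesPauli (pauliBasisEnsemble.unitary k).1ᴴ := by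
  change Fin 3 at k
  fin_cases k
  · exact ⟨permutesPauli_one, by simpa [pauliBasisEnsemble] using permutesPauli_one⟩
  · exact ⟨permutesPauli_hadamard, by
      simpa [pauliBasisEnsemble, hadamard_conjTranspose] using permutesPauli_hadamard⟩
  · refine ⟨permutesPauli_hadamard.mul permutesPauli_phaseGate_conjTranspose, ?_⟩
    have h := permutesPauli_phaseGate.mul permutesPauli_hadamard
    have h2 : phaseGate * hadamard = (hadamard * phaseGateᴴ)ᴴ := by
      rw [Matrix.conjTranspose_mul, Matrix.conjTranspose_conjTranspose, hadamard_conjTranspose]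
    rw [h2] at h
    exact h

namespace UnitaryEnsemble

theorem tomographicallyComplete_localPauliBasis (d : ℕ) :
    (localPauliBasis d).TomographicallyComplete :=
  tomographicallyComplete_pauliBasisEnsemble.localEnsemble d

/-- Products of `I`, `H`, `H S†` are Clifford, so all snapshots of the complete local Pauli ensemble
are available here; a larger supply of snapshots keeps completeness. -/
theorem tomographicallyComplete_jointClifford (d : ℕ) :
    (jointClifford d).TomographicallyComplete := by
  refine (tomographicallyComplete_localPauliBasis d).of_snapshot fun r => ?_
  have hg : (localPauliBasis d).unitary r.index ∈ cliffordGroup d :=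
    mem_cliffordGroup_of_permutesPauli
      (fun k => (pauliBasisEnsemble.unitary (r.index k)).1)
      (fun k => (pauliBasisEnsemble_permutesPauli _).1)
      (fun k => (pauliBasisEnsemble_permutesPauli _).2) _ rfl
  exact ⟨⟨QuotientGroup.mk ⟨_, hg⟩, r.outcome⟩, snapshot_mk_out _ _⟩

theorem tomographicallyComplete_localClifford (d : ℕ) :
    (localClifford d).TomographicallyComplete :=
  ((tomographicallyComplete_jointClifford 1).reindex _).localEnsemble d

/-! ### Unbiased estimates and the mean of one increment -/

variable {m : Type} [Fintype m] [DecidableEq m] (E : UnitaryEnsemble m)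

theorem snapshot_mul_trace_eq_born (ρ : DensityMatrix m) (r : E.Record) :
    (E.snapshot r * ρ.mat).trace = (E.born ρ r : ℂ) := by
  refine (Complex.conj_eq_iff_re.1 ?_).symm
  change star _ = _
  rw [← Matrix.trace_conjTranspose, Matrix.conjTranspose_mul, E.snapshot_conjTranspose,
    ρ.posSemidef.isHermitian.eq, Matrix.trace_mul_comm]

/-- The classical shadow estimate is unbiased. -/
theorem sum_born_mul_estimate (hE : IsUnit E.channel) (O : Matrix m m ℂ) (ρ : DensityMatrix m) :
    (Fintype.card E.Index : ℝ)⁻¹ * ∑ r, E.born ρ r * E.estimate O r = expectation O ρ := by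
  have h1 : (Ring.inverse E.channel) (E.channel ρ.mat) = ρ.mat := by
    rw [← Module.End.mul_apply, Ring.inverse_mul_cancel _ hE, Module.End.one_apply]
  have h2 : (Fintype.card E.Index : ℂ)⁻¹ • ∑ r, (E.born ρ r : ℂ) • E.shadow r = ρ.mat := by
    rw [← h1]
    change _ = (Ring.inverse E.channel) ((Fintype.card E.Index : ℂ)⁻¹ •
      ∑ r : E.Record, (E.snapshot r * ρ.mat).trace • E.snapshot r)
    simp only [map_smul, map_sum, snapshot_mul_trace_eq_born]
    rfl
  have h3 := congrArg (fun B => (O * B).trace.re) h2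
  simp only [Matrix.mul_smul, Matrix.mul_sum, Matrix.trace_smul, Matrix.trace_sum, smul_eq_mul] at h3
  rw [expectation, Matrix.trace_mul_comm, ← h3]
  have h4 : (Fintype.card E.Index : ℂ)⁻¹ = (((Fintype.card E.Index : ℝ)⁻¹ : ℝ) : ℂ) := by simp
  rw [h4, Complex.re_ofReal_mul, Complex.re_sum]
  simp only [Complex.re_ofReal_mul, estimate]

/-- The multiplier is affine in the estimate, so its minimum sits at an extreme value, chosen by the
sign of `b`. There are finitely many records, so the infimum and supremum are genuine bounds. -/
theorem one_add_mul_estimate_pos {O : Matrix m m ℂ} {b : ℝ} (hb : b ∈ E.admissibleBets O)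
    (r : E.Record) : 0 < 1 + b * E.estimate O r := by
  have hfin := Set.finite_range (E.estimate O)
  rcases le_total 0 b with h | h
  · have := mul_le_mul_of_nonneg_left (ciInf_le hfin.bddBelow r) h
    exact hb.1.trans_le (by simpa [estimateMin] using this)
  · have := mul_le_mul_of_nonpos_left (le_ciSup hfin.bddAbove r) h
    exact hb.2.trans_le (by simpa [estimateMax] using this)

/-- By unbiasedness the mean is exactly `1 + b ⟨O⟩`. Only the sign of the product `b ⟨O⟩` matters.
-/
theorem sum_roundLaw_mul_le_one (hE : IsUnit E.channel) {O : Matrix m m ℂ} {b : ℝ}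
    (hb : b ∈ E.admissibleBets O) (ρ : DensityMatrix m) (hρ : b * expectation O ρ ≤ 0) :
    ∑ r, E.roundLaw ρ r * ENNReal.ofReal (1 + b * E.estimate O r) ≤ 1 := by
  have hcard : (0 : ℝ) < Fintype.card E.Index := by exact_mod_cast Fintype.card_pos
  have hlaw : ∀ r, E.roundLaw ρ r =
      ENNReal.ofReal ((Fintype.card E.Index : ℝ)⁻¹ * E.born ρ r) := by
    intro r
    rw [ENNReal.ofReal_mul (by positivity), ENNReal.ofReal_inv_of_pos hcard, ENNReal.ofReal_natCast]
    rfl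
  have hnn : ∀ r, 0 ≤ (Fintype.card E.Index : ℝ)⁻¹ * E.born ρ r := fun r =>
    mul_nonneg (by positivity) (E.born_nonneg ρ r)
  have hborn : ∑ r, E.born ρ r = Fintype.card E.Index := by
    rw [← E.recordEquiv.sum_comp, Fintype.sum_prod_type]
    have : ∀ u : E.Index, ∑ x, E.born ρ (E.recordEquiv (u, x)) = 1 := E.sum_born ρ
    simp [this]
  calc ∑ r, E.roundLaw ρ r * ENNReal.ofReal (1 + b * E.estimate O r)
      = ENNReal.ofReal (∑ r, (Fintype.card E.Index : ℝ)⁻¹ * E.born ρ r *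
          (1 + b * E.estimate O r)) := by
        rw [ENNReal.ofReal_sum_of_nonneg fun r _ =>
          mul_nonneg (hnn r) (E.one_add_mul_estimate_pos hb r).le]
        exact Finset.sum_congr rfl fun r _ => by rw [hlaw, ENNReal.ofReal_mul (hnn r)]
    _ = ENNReal.ofReal (1 + b * expectation O ρ) := by
        congr 1
        rw [← E.sum_born_mul_estimate hE]
        have h : ∀ r, (Fintype.card E.Index : ℝ)⁻¹ * E.born ρ r * (1 + b * E.estimate O r) =
            (Fintype.card E.Index : ℝ)⁻¹ * E.born ρ r +
              b * ((Fintype.card E.Index : ℝ)⁻¹ * (E.born ρ r * E.estimate O r)) := fun r => by ring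
        simp only [h, Finset.sum_add_distrib, ← Finset.mul_sum]
        rw [hborn, inv_mul_cancel₀ hcard.ne']
    _ ≤ 1 := by
        rw [ENNReal.ofReal_le_one]
        linarith

/-! ### Conditioning on the past -/

theorem measurable_of_history {β : Type*} [MeasurableSpace β] (t : ℕ)
    (G : (Fin t → E.Record) → β) : Measurable fun ω : ℕ → E.Record => G fun s => ω s :=
  (Measurable.of_discrete (f := G)).comp (measurable_pi_lambda _ fun s => measurable_pi_apply _)

instance (ρ : ℕ → DensityMatrix m) : IsProbabilityMeasure (E.law ρ) := by
  unfold law; infer_instance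

/-- The record of a round is independent of the previous records. -/
theorem law_map_history (ρ : ℕ → DensityMatrix m) (t : ℕ) :
    (E.law ρ).map (fun ω => ((fun s : Fin t => ω s), ω t)) =
      ((E.law ρ).map fun ω (s : Fin t) => ω s).prod (E.roundLaw (ρ t)).toMeasure := by
  have hind : ProbabilityTheory.iIndepFun (fun (i : ℕ) (ω : ℕ → E.Record) => ω i) (E.law ρ) :=
    ProbabilityTheory.iIndepFun_infinitePi (X := fun _ x => x) fun _ => measurable_id
  have hlast : Measurable fun f : ({t} : Finset ℕ) → E.Record =>
      f ⟨t, Finset.mem_singleton_self t⟩ := measurable_pi_apply _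
  have h := (hind.indepFun_finset (Finset.range t) {t} (by simp) fun i => measurable_pi_apply i).comp
    (φ := fun f (s : Fin t) => f ⟨s, Finset.mem_range.2 s.2⟩)
    (ψ := fun f => f ⟨t, Finset.mem_singleton_self t⟩)
    (measurable_pi_lambda _ fun s => measurable_pi_apply _) hlast
  have h2 := h.map_prod_eq_prod_map_map
    (measurable_pi_lambda _ fun s => measurable_pi_apply _).aemeasurable
    (measurable_pi_apply t).aemeasurable
  have h3 : (E.law ρ).map (fun ω => ω t) = (E.roundLaw (ρ t)).toMeasure :=
    Measure.infinitePi_map_eval _ t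
  rw [← h3]
  exact h2

/-- Fubini in place of conditional expectation: the fresh record is independent of the history, so
for a frozen history the factor `f` integrates to at most 1. Histories form a finite discrete space,
so measurability is automatic. -/
theorem lintegral_history_mul_le (ρ : ℕ → DensityMatrix m) (t : ℕ)
    (g : (Fin t → E.Record) → ℝ≥0∞) (f : (Fin t → E.Record) → E.Record → ℝ≥0∞)
    (hf : ∀ h, ∑ r, E.roundLaw (ρ t) r * f h r ≤ 1) :
    ∫⁻ ω, g (fun s => ω s) * f (fun s => ω s) (ω t) ∂(E.law ρ) ≤
      ∫⁻ ω, g (fun s => ω s) ∂(E.law ρ) := by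
  have hm : Measurable fun ω : ℕ → E.Record => (fun s : Fin t => ω s) :=
    measurable_pi_lambda _ fun s => measurable_pi_apply _
  have hm2 : Measurable fun ω : ℕ → E.Record => ((fun s : Fin t => ω s), ω t) :=
    hm.prodMk (measurable_pi_apply t)
  calc ∫⁻ ω, g (fun s => ω s) * f (fun s => ω s) (ω t) ∂(E.law ρ)
      = ∫⁻ p, g p.1 * f p.1 p.2 ∂((E.law ρ).map fun ω => ((fun s : Fin t => ω s), ω t)) :=
        (lintegral_map (f := fun p : (Fin t → E.Record) × E.Record => g p.1 * f p.1 p.2)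
          Measurable.of_discrete hm2).symm
    _ = ∫⁻ h, ∫⁻ r, g h * f h r ∂(E.roundLaw (ρ t)).toMeasure
          ∂((E.law ρ).map fun ω (s : Fin t) => ω s) := by
        rw [law_map_history, lintegral_prod _ Measurable.of_discrete.aemeasurable]
    _ ≤ ∫⁻ h, g h ∂((E.law ρ).map fun ω (s : Fin t) => ω s) := by
        refine lintegral_mono fun h => ?_
        rw [lintegral_const_mul _ Measurable.of_discrete, lintegral_fintype]
        refine mul_le_of_le_one_right' (le_trans (le_of_eq ?_) (hf h))
        refine Finset.sum_congr rfl fun r _ => ?_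
        rw [PMF.toMeasure_apply_singleton _ _ (measurableSet_singleton r), mul_comm]
    _ = _ := lintegral_map Measurable.of_discrete hm

/-! ### Causality and comparison of the detectors -/

theorem increment_congr (O : Matrix m m ℂ) (bet : E.Bets) {ω ω' : ℕ → E.Record} {t : ℕ}
    (h : ∀ s ≤ t, ω s = ω' s) : E.increment O bet ω t = E.increment O bet ω' t := by
  have h1 : (fun s : Fin t => ω s) = fun s : Fin t => ω' s := funext fun s => h s s.2.le
  rw [increment, increment, h1, h t le_rfl]

theorem srSingle_congr (O : Matrix m m ℂ) (bet : E.Bets) {ω ω' : ℕ → E.Record} {t : ℕ}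
    (h : ∀ s < t, ω s = ω' s) : E.srSingle O bet ω t = E.srSingle O bet ω' t := by
  induction t with
  | zero => rfl
  | succ t ih =>
    rw [srSingle, srSingle, ih fun s hs => h s (hs.trans t.lt_succ_self),
      E.increment_congr O bet fun s hs => h s (Nat.lt_succ_of_le hs)]

variable {n : ℕ} {O : Fin n → Matrix m m ℂ} {bet : Fin n → E.Bets}

theorem srDetector_congr (w : Fin n → ℝ) {ω ω' : ℕ → E.Record} {t : ℕ}
    (h : ∀ s < t, ω s = ω' s) : E.srDetector O w bet ω t = E.srDetector O w bet ω' t :=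
  Finset.sum_congr rfl fun i _ => by rw [E.srSingle_congr _ _ h]

theorem increment_pos (hbet : ∀ i t h, bet i t h ∈ E.admissibleBets (O i)) (i : Fin n)
    (ω : ℕ → E.Record) (t : ℕ) : 0 < E.increment (O i) (bet i) ω t :=
  E.one_add_mul_estimate_pos (hbet i t _) _

theorem srSingle_nonneg (hbet : ∀ i t h, bet i t h ∈ E.admissibleBets (O i)) (i : Fin n)
    (ω : ℕ → E.Record) (t : ℕ) : 0 ≤ E.srSingle (O i) (bet i) ω t := by
  induction t with
  | zero => exact le_rfl
  | succ t ih => exact mul_nonneg (E.increment_pos hbet i ω t).le (by linarith)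

/-- Inductively `max C 1 ≤ S + 1`, because `C ≤ S` and `0 ≤ S`; the common increment is positive. -/
theorem cusumSingle_le_srSingle (hbet : ∀ i t h, bet i t h ∈ E.admissibleBets (O i)) (i : Fin n)
    (ω : ℕ → E.Record) (t : ℕ) :
    E.cusumSingle (O i) (bet i) ω t ≤ E.srSingle (O i) (bet i) ω t := by
  induction t with
  | zero => exact le_rfl
  | succ t ih =>
    refine mul_le_mul_of_nonneg_left (max_le ?_ ?_) (E.increment_pos hbet i ω t).le
    · linarith
    · linarith [E.srSingle_nonneg hbet i ω t]

theorem stopSR_le_stopCU (hbet : ∀ i t h, bet i t h ∈ E.admissibleBets (O i)) {w : Fin n → ℝ}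
    (hw : ∀ i, 0 ≤ w i) (α : ℝ) (ω : ℕ → E.Record) :
    E.stopSR O w bet α ω ≤ E.stopCU O w bet α ω := by
  refine le_iInf₂ fun t ht => iInf₂_le t ⟨ht.1, ht.2.trans ?_⟩
  exact Finset.sum_le_sum fun i _ =>
    mul_le_mul_of_nonneg_left (E.cusumSingle_le_srSingle hbet i ω t) (hw i)

/-- Average run length bound for eSCD, when every bet is unfavourable in the state it is placed on. -/
theorem le_meanTime_stopSR (hE : IsUnit E.channel) {w : Fin n → ℝ} (hw : ∀ i, 0 ≤ w i)
    (hw1 : ∑ i, w i = 1) (hbet : ∀ i t h, bet i t h ∈ E.admissibleBets (O i)) (α : ℝ)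
    (ρ : ℕ → DensityMatrix m) (hρ : ∀ i t h, bet i t h * expectation (O i) (ρ t) ≤ 0) :
    ENNReal.ofReal (1 / α) ≤ E.meanTime ρ (E.stopSR O w bet α) := by
  obtain ⟨r₀, -⟩ := (E.roundLaw (ρ 0)).support_nonempty
  -- Padding a finite history with an arbitrary record `r₀` exhibits any quantity known after `t`
  -- rounds as a function on `Fin t → E.Record`.
  let ext (t : ℕ) (h : Fin t → E.Record) (s : ℕ) : E.Record := if hs : s < t then h ⟨s, hs⟩ else r₀
  have hext : ∀ (t : ℕ) (ω : ℕ → E.Record), ∀ s < t, ext t (fun s => ω s) s = ω s :=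
    fun t ω s hs => by simp [ext, hs]
  have hdet : ∀ t ω, E.srDetector O w bet ω t = E.srDetector O w bet (ext t fun s => ω s) t :=
    fun t ω => E.srDetector_congr w fun s hs => (hext t ω s hs).symm
  have hmeas : ∀ t, Measurable fun ω => E.srDetector O w bet ω t := by
    intro t
    rw [funext (hdet t)]
    exact E.measurable_of_history t fun h => E.srDetector O w bet (ext t h) t
  refine ofReal_le_lintegral_firstPassage (E.law ρ) (E.srDetector O w bet) (1 / α) hmeas
    (fun ω => by simp [srDetector, srSingle]) fun t => ?_
  set c := 1 / α
  set A : Set (ℕ → E.Record) := {ω | ∀ s ∈ Finset.Icc 1 t, E.srDetector O w bet ω s < c}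
  have hA : MeasurableSet A := by
    have : A = ⋂ s ∈ Finset.Icc 1 t, {ω | E.srDetector O w bet ω s < c} := by ext; simp [A]
    rw [this]
    exact Finset.measurableSet_biInter _ fun s _ => measurableSet_lt (hmeas s) measurable_const
  have hAext : ∀ ω, ω ∈ A ↔ ext t (fun s => ω s) ∈ A := by
    intro ω
    refine forall₂_congr fun s hs => ?_
    rw [E.srDetector_congr w fun s' hs' =>
      (hext t ω s' (hs'.trans_le (Finset.mem_Icc.1 hs).2)).symm]
  -- The part of the next detector value already known after `t` rounds, restricted to paths not yet
  -- stopped; multiplying by the fresh increment gives the `i`-th summand at time `t + 1`.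
  let G (i : Fin n) (ω : ℕ → E.Record) : ℝ≥0∞ :=
    A.indicator (fun ω => ENNReal.ofReal (w i * (E.srSingle (O i) (bet i) ω t + 1))) ω
  have hGext : ∀ i ω, G i ω = G i (ext t fun s => ω s) := by
    intro i ω
    by_cases h : ω ∈ A
    · simp only [G, Set.indicator_of_mem h, Set.indicator_of_mem ((hAext ω).1 h)]
      rw [E.srSingle_congr _ _ fun s hs => (hext t ω s hs).symm]
    · simp only [G, Set.indicator_of_notMem h, Set.indicator_of_notMem (mt (hAext ω).2 h)]
  have hGm : ∀ i, Measurable (G i) := by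
    intro i
    rw [funext (hGext i)]
    exact E.measurable_of_history t fun h => G i (ext t h)
  have hincm : ∀ i, Measurable fun ω => ENNReal.ofReal (E.increment (O i) (bet i) ω t) := by
    intro i
    refine ENNReal.measurable_ofReal.comp ?_
    have := (E.measurable_of_history t (bet i t)).mul
      ((Measurable.of_discrete (f := E.estimate (O i))).comp (measurable_pi_apply t))
    exact measurable_const.add this
  have hbound : ∀ i, ∫⁻ ω, G i ω * ENNReal.ofReal (E.increment (O i) (bet i) ω t) ∂(E.law ρ) ≤
      ∫⁻ ω, G i ω ∂(E.law ρ) := by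
    intro i
    rw [funext (hGext i)]
    exact E.lintegral_history_mul_le ρ t (fun h => G i (ext t h))
      (fun h r => ENNReal.ofReal (1 + bet i t h * E.estimate (O i) r))
      fun h => E.sum_roundLaw_mul_le_one hE (hbet i t h) (ρ t) (hρ i t h)
  have hnn : ∀ i ω, 0 ≤ w i * (E.srSingle (O i) (bet i) ω t + 1) := fun i ω =>
    mul_nonneg (hw i) (by linarith [E.srSingle_nonneg hbet i ω t])
  rw [← lintegral_indicator hA, ← lintegral_indicator hA]
  calc ∫⁻ ω, A.indicator (fun ω => ENNReal.ofReal (E.srDetector O w bet ω (t + 1))) ω ∂(E.law ρ)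
      = ∫⁻ ω, ∑ i, G i ω * ENNReal.ofReal (E.increment (O i) (bet i) ω t) ∂(E.law ρ) := by
        refine lintegral_congr fun ω => ?_
        by_cases h : ω ∈ A
        · simp only [G, Set.indicator_of_mem h]
          rw [srDetector, ENNReal.ofReal_sum_of_nonneg fun i _ =>
            mul_nonneg (hw i) (E.srSingle_nonneg hbet i ω _)]
          refine Finset.sum_congr rfl fun i _ => ?_
          rw [← ENNReal.ofReal_mul (hnn i ω), srSingle]
          congr 1
          ring
        · simp [G, Set.indicator_of_notMem h]
    _ = ∑ i, ∫⁻ ω, G i ω * ENNReal.ofReal (E.increment (O i) (bet i) ω t) ∂(E.law ρ) :=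
        lintegral_finsetSum _ fun i _ => (hGm i).mul (hincm i)
    _ ≤ ∑ i, ∫⁻ ω, G i ω ∂(E.law ρ) := Finset.sum_le_sum fun i _ => hbound i
    _ = ∫⁻ ω, ∑ i, G i ω ∂(E.law ρ) := (lintegral_finsetSum _ fun i _ => hGm i).symm
    _ = _ := by
        refine lintegral_congr fun ω => ?_
        by_cases h : ω ∈ A
        · simp only [G, Set.indicator_of_mem h]
          -- The weights sum to one, so the `n` unit injections add up to a single `+ 1`.
          rw [← ENNReal.ofReal_sum_of_nonneg fun i _ => hnn i ω, ← ENNReal.ofReal_one, srDetector,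
            ← ENNReal.ofReal_add (Finset.sum_nonneg fun i _ =>
              mul_nonneg (hw i) (E.srSingle_nonneg hbet i ω _)) zero_le_one]
          simp only [mul_add, mul_one, Finset.sum_add_distrib, hw1]
        · simp [G, Set.indicator_of_notMem h]

theorem meanTime_mono (ρ : ℕ → DensityMatrix m) {T T' : (ℕ → E.Record) → ℕ∞}
    (h : ∀ ω, T ω ≤ T' ω) : E.meanTime ρ T ≤ E.meanTime ρ T' :=
  lintegral_mono fun ω => ENat.toENNReal_le.2 (h ω)

theorem le_arl {ρ₀ : DensityMatrix m} (hρ₀ : ρ₀ ∈ preChange O) (T : (ℕ → E.Record) → ℕ∞) :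
    E.meanTime (fun _ => ρ₀) T ≤ E.arl O T :=
  le_iSup₂_of_le ρ₀ hρ₀ le_rfl

end UnitaryEnsemble

open scoped Matrix.Norms.L2Operator MatrixOrder in
-- Write `O = B† B`; by cyclicity the trace is that of the positive semidefinite matrix `B ρ B†`.
theorem expectation_nonneg {m : Type} [Fintype m] {O : Matrix m m ℂ} (hO : O.PosSemidef)
    (ρ : DensityMatrix m) : 0 ≤ expectation O ρ := by
  classical
  obtain ⟨B, rfl⟩ := (CStarAlgebra.nonneg_iff_eq_star_mul_self).1 hO.nonneg
  have h := (ρ.posSemidef.mul_mul_conjTranspose_same B).trace_nonneg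
  rw [expectation, Matrix.star_eq_conjTranspose, ← Matrix.mul_assoc, Matrix.trace_mul_comm,
    ← Matrix.mul_assoc]
  exact (Complex.le_def.1 h).1

end ESCD

open ESCD UnitaryEnsemble

theorem theorem1 {d n : ℕ} (E : ESCD.UnitaryEnsemble (Fin d → Fin 2))
    (hE : E = ESCD.localClifford d ∨ E = ESCD.localPauliBasis d ∨ E = ESCD.jointClifford d)
    (O : Fin n → Matrix (Fin d → Fin 2) (Fin d → Fin 2) ℂ) (hO : ∀ i, (O i).IsHermitian)
    (w : Fin n → ℝ) (hw : ∀ i, 0 < w i) (hw1 : ∑ i, w i = 1)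
    (bet : Fin n → E.Bets) (hbet : ∀ i t h, bet i t h ∈ E.admissibleBets (O i))
    (α : ℝ) (hα0 : 0 < α) (hα1 : α < 1) :
    -- the measurement channel is invertible, so that the classical shadows are well defined
    IsUnit E.channel ∧
    ((∀ i, (O i).PosSemidef ∨ ∀ t h, 0 ≤ bet i t h) →
      (∀ ρ : ℕ → ESCD.DensityMatrix (Fin d → Fin 2), (∀ t, ρ t ∈ ESCD.preChange O) →
        ENNReal.ofReal (1 / α) ≤ E.meanTime ρ (E.stopSR O w bet α) ∧
        ENNReal.ofReal (1 / α) ≤ E.meanTime ρ (E.stopCU O w bet α)) ∧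
      ((ESCD.preChange O).Nonempty →
        ENNReal.ofReal (1 / α) ≤ E.arl O (E.stopSR O w bet α) ∧
        ENNReal.ofReal (1 / α) ≤ E.arl O (E.stopCU O w bet α))) ∧
    ((∃ ρ₀ : ESCD.DensityMatrix (Fin d → Fin 2), ∀ i, ESCD.expectation (O i) ρ₀ = 0) →
      ENNReal.ofReal (1 / α) ≤ E.arl O (E.stopSR O w bet α) ∧
      ENNReal.ofReal (1 / α) ≤ E.arl O (E.stopCU O w bet α)) := by
  have hunit : IsUnit E.channel := by
    rcases hE with rfl | rfl | rfl
    · exact (tomographicallyComplete_localClifford d).isUnit_channel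
    · exact (tomographicallyComplete_localPauliBasis d).isUnit_channel
    · exact (tomographicallyComplete_jointClifford d).isUnit_channel
  have hmean : ∀ ρ : ℕ → DensityMatrix (Fin d → Fin 2),
      (∀ i t h, bet i t h * expectation (O i) (ρ t) ≤ 0) →
      ENNReal.ofReal (1 / α) ≤ E.meanTime ρ (E.stopSR O w bet α) ∧
      ENNReal.ofReal (1 / α) ≤ E.meanTime ρ (E.stopCU O w bet α) := by
    intro ρ hρ
    have h := E.le_meanTime_stopSR hunit (fun i => (hw i).le) hw1 hbet α ρ hρ
    exact ⟨h, h.trans (E.meanTime_mono ρ (E.stopSR_le_stopCU hbet (fun i => (hw i).le) α))⟩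
  have harl : ∀ ρ₀ ∈ preChange O, (∀ i t h, bet i t h * expectation (O i) ρ₀ ≤ 0) →
      ENNReal.ofReal (1 / α) ≤ E.arl O (E.stopSR O w bet α) ∧
      ENNReal.ofReal (1 / α) ≤ E.arl O (E.stopCU O w bet α) := by
    intro ρ₀ hρ₀ h
    have h2 := hmean (fun _ => ρ₀) fun i t => h i t
    exact ⟨h2.1.trans (E.le_arl hρ₀ _), h2.2.trans (E.le_arl hρ₀ _)⟩
  refine ⟨hunit, fun hcase => ?_, fun ⟨ρ₀, hρ₀⟩ =>
    harl ρ₀ (fun i => (hρ₀ i).le) fun i t h => by rw [hρ₀ i, mul_zero]⟩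
  have hneg : ∀ ρ₀ ∈ preChange O, ∀ i t h, bet i t h * expectation (O i) ρ₀ ≤ 0 := by
    intro ρ₀ hρ₀ i t h
    rcases hcase i with hi | hi
    -- A positive semidefinite observable has expectation exactly zero on `S₀`, so the sign of the
    -- bet is irrelevant.
    · rw [le_antisymm (hρ₀ i) (expectation_nonneg hi ρ₀), mul_zero]
    · exact mul_nonpos_of_nonneg_of_nonpos (hi t h) (hρ₀ i)
  exact ⟨fun ρ hρ => hmean ρ fun i t => hneg (ρ t) (hρ t) i t,
    fun ⟨ρ₀, hρ₀⟩ => harl ρ₀ hρ₀ (hneg ρ₀ hρ₀)⟩
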